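/- **Theorem 5.3.** Let $f_1,f_2$ be $C^2$ diffeomorphisms of $\mathbb I=[0,1]$ with $f_i(0)=0$, $f_i(1)=1$ for $i=1,2$, and with $f_1(x)<x<f_2(x)$ for all $x\in(0,1)$. Let $p_1,p_2>0$ with $p_1+p_2=1$. Let $\Sigma_2^+=\{1,2\}^{\mathbb N}$ with the shift $\sigma$, let $\nu^+$ be the Bernoulli measure on $\Sigma_2^+$ under which the symbols are independent and $1,2$ have probabilities $p_1,p_2$, and let $$F^+:\Sigma_2^+\times\mathbb I\to\Sigma_2^+\times\mathbb I,\qquad F^+(\omega,x)=(\sigma\omega,f_{\omega_0}(x)).$$ For $x\in\{0,1\}$ put $L(x)=p_1\ln f_1'(x)+p_2\ln f_2'(x)$ (one-sided derivatives). A Borel probability measure $m$ on $\mathbb I$ is called stationary if $m=p_1\,(f_1)_*m+p_2\,(f_2)_*m$, and a stationary measure $m$ is called ergodic if $\nu^+\times m$ is ergodic for $F^+$. Assume that $L(0)\le 0$ and $L(1)>0$, and that $f_1'(0)$ and $f_2'(0)$ are not both equal to $1$. Then the ergodic stationary measures are exactly the Dirac measures $\delta_0$ and $\delta_1$. -/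

import Mathlib

open MeasureTheory Set

noncomputable section

namespace StepSkew

/-- A self-map of `[0,1]`, extended to a function `ℝ → ℝ` which is constant to the left of `0` and
to the right of `1`. Below it is only ever used on `[0,1]`, where it agrees with `g`. -/
def toReal (g : unitInterval → unitInterval) (x : ℝ) : ℝ :=
  (g (projIcc 0 1 zero_le_one x) : ℝ)

/-- The derivative at `x` of a self-map of `[0,1]`; one-sided at the end points. -/
def fiberDeriv (g : unitInterval → unitInterval) (x : unitInterval) : ℝ :=
  derivWithin (toReal g) (Icc 0 1) (x : ℝ)

/-- `C²` self-maps of `[0,1]` (up to the boundary). -/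
def IsC2 (g : unitInterval → unitInterval) : Prop :=
  ContDiffOn ℝ 2 (toReal g) (Icc 0 1)

/-- `C²` diffeomorphisms of `[0,1]`: `C²` maps with a two-sided `C²` inverse. -/
def IsC2Diffeo (g : unitInterval → unitInterval) : Prop :=
  IsC2 g ∧ ∃ h : unitInterval → unitInterval,
    IsC2 h ∧ Function.LeftInverse h g ∧ Function.RightInverse h g

/-- The one-sided shift on the space `ℕ → ι` of one-sided symbol sequences. -/
def shift {ι : Type*} (ω : ℕ → ι) : ℕ → ι := fun n => ω (n + 1)

/-- The step skew product system `F⁺ (ω, x) = (σ ω, f_{ω₀} x)` over the one-sided shift. -/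
def stepSkewProduct {ι M : Type*} (f : ι → M → M) (z : (ℕ → ι) × M) : (ℕ → ι) × M :=
  (shift z.1, f (z.1 0) z.2)

/-- The conditions on the pair of fiber maps that define the class `𝒮` of step skew product
systems with fiber `[0,1]` over the full shift on two symbols. The symbols `1, 2` are written
`0, 1 : Fin 2`. -/
structure ClassS (f : Fin 2 → unitInterval → unitInterval) : Prop where
  diffeo : ∀ i, IsC2Diffeo (f i)
  map_zero : ∀ i, f i 0 = 0
  map_one : ∀ i, f i 1 = 1
  lt_self : ∀ x, 0 < x → x < 1 → f 0 x < x
  self_lt : ∀ x, 0 < x → x < 1 → x < f 1 x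

/-- The Bernoulli measure `ν⁺` on one-sided symbol sequences: the symbols are independent, each
with law `p`. -/
def bernoulliShift {ι : Type*} [MeasurableSpace ι] (p : PMF ι) : Measure (ℕ → ι) :=
  Measure.infinitePi fun _ : ℕ => p.toMeasure

/-- The fiber Lyapunov exponent `L(x) = ∑ i, p_i ln (f_i'(x))` at a common fixed point `x` of the
fiber maps, that is, at an end point `x = 0` or `x = 1`. -/
def lyapunov (p : PMF (Fin 2)) (f : Fin 2 → unitInterval → unitInterval) (x : unitInterval) : ℝ :=
  ∑ i, (p i).toReal * Real.log (fiberDeriv (f i) x)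

/-- Stationary measures: probability measures `m` with `m = ∑ i, p_i (f_i)_* m`. -/
def IsStationary {ι M : Type*} [Fintype ι] [MeasurableSpace M] (p : PMF ι) (f : ι → M → M)
    (m : Measure M) : Prop :=
  IsProbabilityMeasure m ∧ m = ∑ i, p i • m.map (f i)

/-- Ergodic stationary measures: stationary measures `m` such that `ν⁺ × m` is ergodic
for `F⁺`. -/
def IsErgodicStationary {ι M : Type*} [Fintype ι] [MeasurableSpace ι] [MeasurableSpace M]
    (p : PMF ι) (f : ι → M → M) (m : Measure M) : Prop :=
  IsStationary p f m ∧ Ergodic (stepSkewProduct f) ((bernoulliShift p).prod m)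

end StepSkew

end

/-!
A stationary measure cannot charge the open interval `(0, 1)`, and this only depends on the
behaviour of the fiber maps at `0`. In the variable `t = - ln x`, the random orbits near `0` follow
a random walk with drift `- L(0) ≥ 0`, up to an error of order `exp (- t)`. Such a walk is transient
or null recurrent, never positive recurrent, so it admits no stationary probability measure.

The quantitative form of this is the Lyapunov function `V = - ln x + √x` (`logPotential`). Its mean
drift `PV - V`, where `P` is the averaging operator of the fiber maps, is strictly positive near `0`
(`exists_drift_logPotential_pos`): if `L(0) < 0`, the logarithm alone has drift tending to `- L(0)`;
if `L(0) = 0`, the drift of the logarithm is bounded below by a multiple of `- x`, by the Taylor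
expansion of the `C²` maps `f_i`, while that of `√x` is of exact order `√x` and positive, by the
strict Jensen inequality and the assumption that the derivatives at `0` are not both `1`.
The function `h = max (V - T) 0` then has nonnegative drift everywhere, positive drift near `0`, and
bounded increments. Bounded increments force the drift to have integral zero for any stationary
measure (`IsStationary.integral_drift_eq_zero`), even though `h` need not be integrable, so that
a neighbourhood `(0, δ)` of `0` is null. Every point of `(0, 1)` is carried into `(0, δ)` by iterates
of the first map, and preimages of null sets are null, hence `(0, 1)` is null (`measure_Ioo_eq_zero`).

Ergodicity singles out one of the two end points, because `Σ × {0}` is invariant. Conversely, over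
a common fixed point the skew product is a copy of the Bernoulli shift, which is ergodic by
Kolmogorov's zero-one law (`ergodic_shift`).
-/

namespace StepSkew

open Filter Topology ProbabilityTheory

/-! ### Ergodicity of the Bernoulli shift -/

instance isProbabilityMeasure_bernoulliShift {ι : Type*} [MeasurableSpace ι] (p : PMF ι) :
    IsProbabilityMeasure (bernoulliShift p) := by
  unfold bernoulliShift; infer_instance

theorem measurable_shift {ι : Type*} [MeasurableSpace ι] :
    Measurable (shift : (ℕ → ι) → ℕ → ι) :=
  measurable_pi_lambda _ fun n => measurable_pi_apply (n + 1)

theorem shift_iterate_apply {ι : Type*} (n k : ℕ) (ω : ℕ → ι) :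
    shift^[n] ω k = ω (k + n) := by
  induction n generalizing ω with
  | zero => rfl
  | succ n ih => rw [Function.iterate_succ_apply, ih]; rfl

/-- The shift-invariant sets lie in the tail `σ`-algebra, which is trivial by Kolmogorov's
zero-one law. -/
theorem ergodic_shift {ι : Type*} [MeasurableSpace ι] (p : PMF ι) :
    Ergodic (shift : (ℕ → ι) → ℕ → ι) (bernoulliShift p) where
  measurable := measurable_shift
  map_eq := Measure.map_infinitePi_infinitePi_of_inj (P := fun _ : ℕ => p.toMeasure)
    (add_left_injective 1)
  aeconst_set s hs hinv := by
    have hind : iIndep (fun n : ℕ => MeasurableSpace.comap (fun ω : ℕ → ι => ω n) inferInstance)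
        (bernoulliShift p) :=
      iIndepFun_infinitePi (P := fun _ : ℕ => p.toMeasure) (X := fun _ x => x)
        fun _ => measurable_id
    have htail : MeasurableSet[limsup
        (fun n : ℕ => MeasurableSpace.comap (fun ω : ℕ → ι => ω n) inferInstance) atTop] s := by
      rw [limsup_eq_iInf_iSup_of_nat', MeasurableSpace.measurableSet_iInf]
      intro n
      have hn : shift^[n] ⁻¹' s = s := Function.IsFixedPt.preimage_iterate hinv n
      rw [← hn]
      refine @measurable_pi_lambda _ _ _ (_) _ _ (fun k => ?_) s hs
      simp only [shift_iterate_apply]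
      rw [measurable_iff_comap_le]
      exact le_iSup (fun i : ℕ => MeasurableSpace.comap (fun ω : ℕ → ι => ω (i + n))
        inferInstance) k
    have h01 := measure_zero_or_one_of_measurableSet_limsup_atTop
      (fun n => (measurable_pi_apply n).comap_le) hind htail
    rw [eventuallyConst_set']
    rcases h01 with h | h
    · exact Or.inl (ae_eq_empty.2 h)
    · exact Or.inr (ae_eq_univ.2 ((prob_compl_eq_zero_iff hs).2 h))

/-! ### Point masses at common fixed points -/

theorem measurable_stepSkewProduct {ι M : Type*} [Countable ι] [MeasurableSpace ι]
    [MeasurableSingletonClass ι] [MeasurableSpace M] {f : ι → M → M} (hf : ∀ i, Measurable (f i)) :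
    Measurable (stepSkewProduct f) := by
  have hm : Measurable fun z : ι × M => f z.1 z.2 := measurable_from_prod_countable_right hf
  have hπ : Measurable fun z : (ℕ → ι) × M => (z.1 0, z.2) :=
    ((measurable_pi_apply 0).comp measurable_fst).prodMk measurable_snd
  exact (measurable_shift.comp measurable_fst).prodMk (hm.comp hπ)

/-- Over a common fixed point the skew product is a copy of the Bernoulli shift. -/
theorem isErgodicStationary_dirac {ι M : Type*} [Fintype ι] [MeasurableSpace ι]
    [MeasurableSingletonClass ι] [MeasurableSpace M] (p : PMF ι) {f : ι → M → M}
    (hf : ∀ i, Measurable (f i)) {c : M} (hc : ∀ i, f i c = c) :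
    IsErgodicStationary p f (Measure.dirac c) := by
  have hι : Measurable fun ω : ℕ → ι => (ω, c) := measurable_prodMk_right
  have hF := measurable_stepSkewProduct hf
  have hconj : stepSkewProduct f ∘ (fun ω : ℕ → ι => (ω, c)) = (fun ω => (ω, c)) ∘ shift := by
    funext ω
    simp [stepSkewProduct, hc]
  refine ⟨⟨inferInstance, ?_⟩, ?_⟩
  · have hsum : ∑ i, p i = 1 := by rw [← tsum_fintype (L := .unconditional ι)]; exact p.tsum_coe
    simp_rw [fun i => Measure.map_dirac' (hf i) c, hc, ← Finset.sum_smul, hsum, one_smul]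
  · rw [Measure.prod_dirac]
    refine { measurable := hF, map_eq := ?_, aeconst_set := fun s hs hinv => ?_ }
    · rw [Measure.map_map hF hι, hconj, ← Measure.map_map hι measurable_shift,
        (ergodic_shift p).map_eq]
    · have hpre : shift ⁻¹' ((fun ω : ℕ → ι => (ω, c)) ⁻¹' s) = (fun ω => (ω, c)) ⁻¹' s := by
        rw [← preimage_comp, ← hconj, preimage_comp, hinv]
      have h := (ergodic_shift p).measure_self_or_compl_eq_zero (hι hs) hpre
      rw [eventuallyConst_set', ae_eq_empty, ae_eq_univ, Measure.map_apply hι hs,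
        Measure.map_apply hι hs.compl]
      exact h

/-! ### Stationary measures -/

theorem IsStationary.apply_eq_sum {ι M : Type*} [Fintype ι] [MeasurableSpace M] {p : PMF ι}
    {f : ι → M → M} {m : Measure M} (hm : IsStationary p f m) (hf : ∀ i, Measurable (f i))
    {s : Set M} (hs : MeasurableSet s) : m s = ∑ i, p i * m (f i ⁻¹' s) := by
  conv_lhs => rw [hm.2]
  simp [Measure.map_apply (hf _) hs]

theorem IsStationary.measure_preimage_eq_zero {ι M : Type*} [Fintype ι] [MeasurableSpace M]
    {p : PMF ι} {f : ι → M → M} {m : Measure M} (hm : IsStationary p f m)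
    (hf : ∀ i, Measurable (f i)) {s : Set M} (hs : MeasurableSet s) (h0 : m s = 0) {i : ι}
    (hi : 0 < p i) : m (f i ⁻¹' s) = 0 := by
  rw [hm.apply_eq_sum hf hs, Finset.sum_eq_zero_iff] at h0
  exact (mul_eq_zero.1 (h0 i (Finset.mem_univ i))).resolve_left hi.ne'

theorem IsStationary.integral_eq_sum {ι M : Type*} [Fintype ι] [MeasurableSpace M] {p : PMF ι}
    {f : ι → M → M} {m : Measure M} (hm : IsStationary p f m) (hf : ∀ i, Measurable (f i))
    {g : M → ℝ} (hg : Measurable g) {B : ℝ} (hB : ∀ x, |g x| ≤ B) :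
    ∫ x, g x ∂m = ∑ i, (p i).toReal * ∫ x, g (f i x) ∂m := by
  have := hm.1
  have hint : ∀ i, Integrable g (m.map (f i)) := fun i =>
    have := Measure.isProbabilityMeasure_map (μ := m) (hf i).aemeasurable
    Integrable.of_bound hg.aestronglyMeasurable B (ae_of_all _ hB)
  conv_lhs => rw [hm.2]
  rw [integral_finsetSum_measure fun i _ => (hint i).smul_measure (p.apply_ne_top i)]
  refine Finset.sum_congr rfl fun i _ => ?_
  rw [integral_smul_measure, integral_map (hf i).aemeasurable hg.aestronglyMeasurable, smul_eq_mul]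

/-- A nonnegative function with bounded increments has zero mean drift under a stationary
measure, even if it is not integrable itself. -/
theorem IsStationary.integral_drift_eq_zero {ι M : Type*} [Fintype ι] [MeasurableSpace M]
    {p : PMF ι} {f : ι → M → M} {m : Measure M} (hm : IsStationary p f m)
    (hf : ∀ i, Measurable (f i)) {h : M → ℝ} (hh : Measurable h) (h0 : ∀ x, 0 ≤ h x)
    {B : ℝ} (hB : ∀ i x, |h (f i x) - h x| ≤ B) :
    ∫ x, ∑ i, (p i).toReal * (h (f i x) - h x) ∂m = 0 := by
  have := hm.1
  have hsum : ∑ i, (p i).toReal = 1 := by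
    rw [← ENNReal.toReal_sum fun i _ => p.apply_ne_top i,
      ← tsum_fintype (L := .unconditional ι), p.tsum_coe, ENNReal.toReal_one]
  -- Each truncation `min h N` is bounded, so its drift has integral zero.
  have htrunc : ∀ N : ℕ,
      ∫ x, ∑ i, (p i).toReal * (min (h (f i x)) N - min (h x) N) ∂m = 0 := by
    intro N
    have hbd : ∀ x, |min (h x) N| ≤ N := fun x => by
      rw [abs_of_nonneg (le_min (h0 x) N.cast_nonneg)]; exact min_le_right _ _
    have hmeas : Measurable fun x => min (h x) (N : ℝ) := hh.min measurable_const
    have hi1 : Integrable (fun x => min (h x) (N : ℝ)) m :=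
      Integrable.of_bound hmeas.aestronglyMeasurable N (ae_of_all _ hbd)
    have hi2 : ∀ i, Integrable (fun x => min (h (f i x)) (N : ℝ)) m := fun i =>
      Integrable.of_bound (hmeas.comp (hf i)).aestronglyMeasurable N (ae_of_all _ fun x => hbd _)
    have hi3 : ∀ i ∈ Finset.univ, Integrable
        (fun x => (p i).toReal * (min (h (f i x)) (N : ℝ) - min (h x) N)) m :=
      fun i _ => ((hi2 i).sub hi1).const_mul _
    rw [integral_finsetSum _ hi3]
    simp_rw [integral_const_mul]
    rw [Finset.sum_congr rfl fun i _ => by rw [integral_sub (hi2 i) hi1, mul_sub],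
      Finset.sum_sub_distrib, ← hm.integral_eq_sum hf hmeas hbd, ← Finset.sum_mul, hsum, one_mul,
      sub_self]
  have hlim := tendsto_integral_of_dominated_convergence (μ := m)
    (F := fun (N : ℕ) x => ∑ i, (p i).toReal * (min (h (f i x)) N - min (h x) N))
    (f := fun x => ∑ i, (p i).toReal * (h (f i x) - h x)) (fun _ => B)
    (fun N => (Finset.measurable_sum _ fun i _ => measurable_const.mul
      (((hh.comp (hf i)).min measurable_const).sub
        (hh.min measurable_const))).aestronglyMeasurable)
    (integrable_const B)
    (fun N => ae_of_all _ fun x => ?_) (ae_of_all _ fun x => ?_)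
  · simp_rw [htrunc] at hlim
    exact tendsto_nhds_unique hlim tendsto_const_nhds
  · have hle : ∀ i, |(p i).toReal * (min (h (f i x)) N - min (h x) N)| ≤ (p i).toReal * B := by
      intro i
      rw [abs_mul, abs_of_nonneg ENNReal.toReal_nonneg]
      refine mul_le_mul_of_nonneg_left ?_ ENNReal.toReal_nonneg
      refine (abs_min_sub_min_le_max _ _ _ _).trans (max_le (hB i x) ?_)
      rw [sub_self, abs_zero]
      exact (abs_nonneg _).trans (hB i x)
    calc ‖∑ i, (p i).toReal * (min (h (f i x)) N - min (h x) N)‖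
        ≤ ∑ i, (p i).toReal * B := (Finset.abs_sum_le_sum_abs _ _).trans
          (Finset.sum_le_sum fun i _ => hle i)
      _ = B := by rw [← Finset.sum_mul, hsum, one_mul]
  · have hmin : ∀ r : ℝ, Tendsto (fun N : ℕ => min r (N : ℝ)) atTop (𝓝 r) := fun r => by
      refine tendsto_const_nhds.congr' ?_
      filter_upwards [tendsto_natCast_atTop_atTop.eventually_ge_atTop r] with N hN
      exact (min_eq_left hN).symm
    exact tendsto_finsetSum _ fun i _ => ((hmin _).sub (hmin _)).const_mul _

/-! ### Local behaviour of the fiber maps at the end point `0` -/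

theorem toReal_coe (g : unitInterval → unitInterval) (x : unitInterval) :
    toReal g x = g x := by
  simp [toReal]

theorem IsC2.continuous {g : unitInterval → unitInterval} (hg : IsC2 g) : Continuous g := by
  rw [continuous_induced_rng]
  have h : Continuous fun x : unitInterval => toReal g x :=
    hg.continuousOn.comp_continuous continuous_subtype_val fun x => x.2
  simpa only [toReal_coe] using! h

/-- First order Taylor expansion at `0`. -/
theorem IsC2.exists_abs_sub_le {g : unitInterval → unitInterval} (hg : IsC2 g) (h0 : g 0 = 0) :
    ∃ C : ℝ, ∀ x : unitInterval, |(g x : ℝ) - fiberDeriv g 0 * x| ≤ C * (x : ℝ) ^ 2 := by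
  obtain ⟨C, hC⟩ := exists_taylor_mean_remainder_bound (n := 1) zero_le_one
    (show ContDiffOn ℝ ((1 : ℕ) + 1) (toReal g) (Icc 0 1) from hg)
  refine ⟨C, fun x => ?_⟩
  have h00 : toReal g 0 = 0 := by
    have := toReal_coe g 0
    simpa [h0] using this
  have := hC x x.2
  rw [taylorWithinEval_succ, taylor_within_zero_eval, toReal_coe, h00] at this
  simpa [fiberDeriv, mul_comm] using this

theorem IsC2.exists_le_mul {g : unitInterval → unitInterval} (hg : IsC2 g) (h0 : g 0 = 0) :
    ∃ K : ℝ, 0 < K ∧ ∀ x : unitInterval, (g x : ℝ) ≤ K * x := by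
  obtain ⟨C, hC⟩ := hg.exists_abs_sub_le h0
  refine ⟨|fiberDeriv g 0| + |C| + 1, by positivity, fun x => ?_⟩
  have h1 := (abs_le.1 (hC x)).2
  have hx0 : (0 : ℝ) ≤ x := x.2.1
  have hx1 : (x : ℝ) ≤ 1 := x.2.2
  nlinarith [mul_le_mul_of_nonneg_right (le_abs_self (fiberDeriv g 0)) hx0,
    mul_le_mul_of_nonneg_right (le_abs_self C) (sq_nonneg (x : ℝ)),
    mul_le_mul_of_nonneg_left (show (x : ℝ) ^ 2 ≤ x by nlinarith) (abs_nonneg C)]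

/-- This is the linear upper bound `IsC2.exists_le_mul` for the inverse of `g`. -/
theorem IsC2Diffeo.exists_le_mul {g : unitInterval → unitInterval} (hg : IsC2Diffeo g)
    (h0 : g 0 = 0) : ∃ K : ℝ, 0 < K ∧ ∀ x : unitInterval, (x : ℝ) ≤ K * g x := by
  obtain ⟨_, h, hh, hl, _⟩ := hg
  obtain ⟨K, hK, hle⟩ := hh.exists_le_mul (by simpa only [h0] using hl 0)
  exact ⟨K, hK, fun x => by simpa only [hl x] using hle (g x)⟩

theorem IsC2Diffeo.pos {g : unitInterval → unitInterval} (hg : IsC2Diffeo g)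
    (h0 : g 0 = 0) {x : unitInterval} (hx : 0 < x) : 0 < g x := by
  obtain ⟨_, h, _, hl, _⟩ := hg
  exact unitInterval.pos_iff_ne_zero.2 fun h1 => hx.ne' (hl.injective (h1.trans h0.symm))

theorem tendsto_coe_nhdsGT_zero :
    Tendsto ((↑) : unitInterval → ℝ) (𝓝[>] 0) (𝓝 0) :=
  (continuous_subtype_val.tendsto (0 : unitInterval)).mono_left nhdsWithin_le_nhds

theorem eventually_coe_pos : ∀ᶠ x : unitInterval in 𝓝[>] 0, (0 : ℝ) < x :=
  eventually_mem_nhdsWithin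

theorem IsC2.tendsto_div {g : unitInterval → unitInterval} (hg : IsC2 g) (h0 : g 0 = 0) :
    Tendsto (fun x : unitInterval => (g x : ℝ) / x) (𝓝[>] 0) (𝓝 (fiberDeriv g 0)) := by
  obtain ⟨C, hC⟩ := hg.exists_abs_sub_le h0
  rw [tendsto_iff_norm_sub_tendsto_zero]
  refine squeeze_zero' (g := fun x : unitInterval => C * x)
    (Eventually.of_forall fun _ => norm_nonneg _) ?_ ?_
  · filter_upwards [eventually_coe_pos] with x hx
    rw [div_sub' hx.ne', norm_div, Real.norm_eq_abs, Real.norm_eq_abs, abs_of_pos hx,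
      div_le_iff₀ hx, mul_comm (x : ℝ)]
    exact (hC x).trans_eq (by ring)
  · simpa using tendsto_coe_nhdsGT_zero.const_mul C

instance nhdsGT_zero_unitInterval_neBot : (𝓝[>] (0 : unitInterval)).NeBot :=
  nhdsGT_neBot_of_exists_gt ⟨1, zero_lt_one⟩

theorem IsC2Diffeo.fiberDeriv_pos {g : unitInterval → unitInterval} (hg : IsC2Diffeo g)
    (h0 : g 0 = 0) : 0 < fiberDeriv g 0 := by
  obtain ⟨K, hK, hle⟩ := hg.exists_le_mul h0
  refine (inv_pos.2 hK).trans_le (ge_of_tendsto (hg.1.tendsto_div h0) ?_)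
  filter_upwards [eventually_coe_pos] with x hx
  rw [le_div_iff₀ hx, inv_mul_le_iff₀ hK]
  exact hle x

theorem IsC2Diffeo.exists_log_div_le {g : unitInterval → unitInterval} (hg : IsC2Diffeo g)
    (h0 : g 0 = 0) : ∃ C : ℝ, ∀ x : unitInterval, 0 < x →
      Real.log ((g x : ℝ) / x) ≤ Real.log (fiberDeriv g 0) + C * x := by
  obtain ⟨C, hC⟩ := hg.1.exists_abs_sub_le h0
  have ha := hg.fiberDeriv_pos h0
  set a := fiberDeriv g 0
  refine ⟨C / a, fun x hx => ?_⟩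
  have hx' : (0 : ℝ) < x := hx
  have hgx : (0 : ℝ) < g x := hg.pos h0 hx
  have h1 := Real.log_le_sub_one_of_pos (show 0 < (g x : ℝ) / x / a by positivity)
  rw [Real.log_div (by positivity) ha.ne'] at h1
  have h2 : (g x : ℝ) / x / a - 1 ≤ C / a * x := by
    rw [div_div, div_sub_one (by positivity), div_le_iff₀ (by positivity)]
    have h3 := (abs_le.1 (hC x)).2
    have h4 : C / a * x * (x * a) = C * (x : ℝ) ^ 2 := by field_simp
    rw [h4]
    linarith
  linarith

/-! ### A Lyapunov function near `0` -/

/-- The function `- ln x + √x`. In the variable `t = - ln x` the leading term is `t`, whose mean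
drift tends to `- L(0)`; the convex term `exp (- t / 2)` dominates the error when `L(0) = 0`. -/
noncomputable def logPotential (x : unitInterval) : ℝ := -Real.log x + √(x : ℝ)

theorem measurable_logPotential : Measurable logPotential :=
  (Real.measurable_log.comp measurable_subtype_coe).neg.add
    (Real.continuous_sqrt.measurable.comp measurable_subtype_coe)

theorem sqrt_coe_le_one (x : unitInterval) : √(x : ℝ) ≤ 1 := Real.sqrt_le_one.2 x.2.2

/-- Strict Jensen inequality for the exponential of a mean zero, nonconstant variable. -/
theorem one_lt_sum_mul_sqrt {q a : Fin 2 → ℝ} (hq : ∀ i, 0 < q i) (hq1 : ∑ i, q i = 1)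
    (ha : ∀ i, 0 < a i) (hlog : ∑ i, q i * Real.log (a i) = 0) (hne : ∃ i, a i ≠ 1) :
    1 < ∑ i, q i * √(a i) := by
  have hle : ∀ i, Real.log (a i) / 2 ≤ √(a i) - 1 := fun i => by
    rw [← Real.log_sqrt (ha i).le]
    exact Real.log_le_sub_one_of_pos (Real.sqrt_pos.2 (ha i))
  obtain ⟨j, hj⟩ := hne
  have hlt : Real.log (a j) / 2 < √(a j) - 1 := by
    rw [← Real.log_sqrt (ha j).le]
    exact Real.log_lt_sub_one_of_pos (Real.sqrt_pos.2 (ha j)) (by simpa using hj)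
  have hs : ∑ i, q i * (Real.log (a i) / 2) < ∑ i, q i * (√(a i) - 1) :=
    Finset.sum_lt_sum (fun i _ => mul_le_mul_of_nonneg_left (hle i) (hq i).le)
      ⟨j, Finset.mem_univ j, mul_lt_mul_of_pos_left hlt (hq j)⟩
  simp_rw [mul_sub, ← mul_div_assoc] at hs
  rw [← Finset.sum_div, hlog, Finset.sum_sub_distrib] at hs
  simp only [mul_one, hq1] at hs
  linarith

theorem exists_drift_logPotential_pos {p : PMF (Fin 2)} (hp : ∀ i, 0 < p i)
    {f : Fin 2 → unitInterval → unitInterval} (hf : ClassS f)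
    (hnd : ¬ (fiberDeriv (f 0) 0 = 1 ∧ fiberDeriv (f 1) 0 = 1)) (hL0 : lyapunov p f 0 ≤ 0) :
    ∃ ε : ℝ, 0 < ε ∧ ∀ x : unitInterval, 0 < x → (x : ℝ) < ε →
      0 < ∑ i, (p i).toReal * (logPotential (f i x) - logPotential x) := by
  have hq : ∀ i, 0 < (p i).toReal := fun i => ENNReal.toReal_pos (hp i).ne' (p.apply_ne_top i)
  have hsum : ∑ i, (p i).toReal = 1 := by
    rw [← ENNReal.toReal_sum fun i _ => p.apply_ne_top i,
      ← tsum_fintype (L := .unconditional _), p.tsum_coe, ENNReal.toReal_one]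
  have ha : ∀ i, 0 < fiberDeriv (f i) 0 := fun i => (hf.diffeo i).fiberDeriv_pos (hf.map_zero i)
  choose C hC using fun i => (hf.diffeo i).exists_log_div_le (hf.map_zero i)
  set D : ℝ := ∑ i, (p i).toReal * C i with hD
  -- `E x` is the mean of `√(f i x / x)`, and `G x` is a lower bound of the drift at `x`.
  set E : unitInterval → ℝ := fun x => ∑ i, (p i).toReal * √((f i x : ℝ) / x) with hE
  set G : unitInterval → ℝ :=
    fun x => -lyapunov p f 0 + √(x : ℝ) * (E x - 1 - D * √(x : ℝ)) with hG
  have hlower : ∀ x : unitInterval, 0 < x →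
      G x ≤ ∑ i, (p i).toReal * (logPotential (f i x) - logPotential x) := by
    intro x hx
    have hx' : (0 : ℝ) < x := hx
    have hterm : ∀ i, (p i).toReal * (-(Real.log (fiberDeriv (f i) 0) + C i * x) +
        √(x : ℝ) * (√((f i x : ℝ) / x) - 1)) ≤
        (p i).toReal * (logPotential (f i x) - logPotential x) := by
      intro i
      refine mul_le_mul_of_nonneg_left ?_ (hq i).le
      have hfx : (0 : ℝ) < f i x := (hf.diffeo i).pos (hf.map_zero i) hx
      have h1 := hC i x hx
      rw [Real.log_div hfx.ne' hx'.ne'] at h1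
      have h2 : √(x : ℝ) * √((f i x : ℝ) / x) = √(f i x : ℝ) := by
        rw [← Real.sqrt_mul hx'.le, mul_div_cancel₀ _ hx'.ne']
      simp only [logPotential]
      rw [mul_sub, h2]
      linarith
    refine le_of_eq_of_le ?_ (Finset.sum_le_sum fun i _ => hterm i)
    have hsq : √(x : ℝ) * √(x : ℝ) = x := Real.mul_self_sqrt hx'.le
    have hsum2 : (p 1).toReal = 1 - (p 0).toReal := by
      rw [Fin.sum_univ_two] at hsum; linarith
    simp only [hG, hE, hD, lyapunov, Fin.sum_univ_two]
    rw [hsum2]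
    linear_combination (-((p 0).toReal * C 0 + (1 - (p 0).toReal) * C 1)) * hsq
  have hsqrt : Tendsto (fun x : unitInterval => √(x : ℝ)) (𝓝[>] 0) (𝓝 0) := by
    simpa using tendsto_coe_nhdsGT_zero.sqrt
  have hElim : Tendsto E (𝓝[>] 0) (𝓝 (∑ i, (p i).toReal * √(fiberDeriv (f i) 0))) :=
    tendsto_finsetSum _ fun i _ =>
      (((hf.diffeo i).1.tendsto_div (hf.map_zero i)).sqrt).const_mul _
  have hbr : Tendsto (fun x => E x - 1 - D * √(x : ℝ)) (𝓝[>] 0)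
      (𝓝 (∑ i, (p i).toReal * √(fiberDeriv (f i) 0) - 1)) := by
    simpa using (hElim.sub_const 1).sub (hsqrt.const_mul D)
  have hpos : ∀ᶠ x in 𝓝[>] (0 : unitInterval), 0 < G x := by
    rcases hL0.lt_or_eq with hL | hL
    · have hlim : Tendsto G (𝓝[>] 0) (𝓝 (-lyapunov p f 0)) := by
        simpa using (hsqrt.mul hbr).const_add (-lyapunov p f 0)
      exact hlim.eventually_const_lt (neg_pos.2 hL)
    · have hne : ∃ i, fiberDeriv (f i) 0 ≠ 1 := by
        by_contra! h
        exact hnd ⟨h 0, h 1⟩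
      have hJ := one_lt_sum_mul_sqrt hq hsum ha hL hne
      filter_upwards [hbr.eventually_const_lt (sub_pos.2 hJ), eventually_coe_pos] with x h1 hx
      simp only [hG, hL, neg_zero, zero_add]
      exact mul_pos (Real.sqrt_pos.2 hx) h1
  obtain ⟨u, hu, hsub⟩ := (mem_nhdsGT_iff_exists_Ioo_subset' zero_lt_one).1 hpos
  exact ⟨u, hu, fun x hx hxu => (hsub ⟨hx, hxu⟩).trans_le (hlower x hx)⟩

/-- The increments are bounded because `g x / x` is bounded away from `0` and `∞`. -/
theorem exists_abs_logPotential_sub_le {g : unitInterval → unitInterval} (hg : IsC2Diffeo g)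
    (h0 : g 0 = 0) : ∃ B : ℝ, ∀ x, |logPotential (g x) - logPotential x| ≤ B := by
  obtain ⟨K, hK, hKle⟩ := hg.1.exists_le_mul h0
  obtain ⟨K', hK', hKle'⟩ := hg.exists_le_mul h0
  refine ⟨|Real.log K| + |Real.log K'| + 1, fun x => ?_⟩
  -- At `x = 0`, where `logPotential` has a junk value, nothing is lost: the point is fixed.
  rcases eq_or_lt_of_le (unitInterval.nonneg' : 0 ≤ x) with rfl | hx
  · rw [h0, sub_self, abs_zero]
    positivity
  have hx' : (0 : ℝ) < x := hx
  have hgx : (0 : ℝ) < g x := hg.pos h0 hx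
  have h1 := Real.log_le_log hgx (hKle x)
  have h2 := Real.log_le_log hx' (hKle' x)
  rw [Real.log_mul hK.ne' hx'.ne'] at h1
  rw [Real.log_mul hK'.ne' hgx.ne'] at h2
  have h3 := sqrt_coe_le_one x
  have h4 := sqrt_coe_le_one (g x)
  have h5 := Real.sqrt_nonneg (x : ℝ)
  have h6 := Real.sqrt_nonneg (g x : ℝ)
  simp only [logPotential]
  rw [abs_le]
  constructor <;> linarith [le_abs_self (Real.log K), le_abs_self (Real.log K'),
    abs_nonneg (Real.log K), abs_nonneg (Real.log K')]

/-! ### Stationary measures do not charge the open interval -/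

/-- The excess of `logPotential` over a high level has nonnegative drift everywhere and positive
drift near `0`, while a stationary measure gives its drift integral zero. -/
theorem exists_measure_Ioo_eq_zero {p : PMF (Fin 2)} (hp : ∀ i, 0 < p i)
    {f : Fin 2 → unitInterval → unitInterval} (hf : ClassS f)
    (hnd : ¬ (fiberDeriv (f 0) 0 = 1 ∧ fiberDeriv (f 1) 0 = 1)) (hL0 : lyapunov p f 0 ≤ 0)
    {m : Measure unitInterval} (hm : IsStationary p f m) :
    ∃ δ : ℝ, 0 < δ ∧ m {x | 0 < x ∧ (x : ℝ) < δ} = 0 := by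
  have := hm.1
  have hfm : ∀ i, Measurable (f i) := fun i => (hf.diffeo i).1.continuous.measurable
  obtain ⟨ε, hε, hdrift⟩ := exists_drift_logPotential_pos hp hf hnd hL0
  choose B hB using fun i => exists_abs_logPotential_sub_le (hf.diffeo i) (hf.map_zero i)
  -- Since `√x ≤ 1`, the potential exceeds `T` only at points of `(0, ε)`.
  set T : ℝ := 1 - Real.log ε with hT
  set h : unitInterval → ℝ := fun x => max (logPotential x - T) 0 with hh
  have hhm : Measurable h := (measurable_logPotential.sub_const T).max measurable_const
  have hhB : ∀ i x, |h (f i x) - h x| ≤ ∑ i, |B i| := fun i x => by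
    calc |h (f i x) - h x| ≤ |(logPotential (f i x) - T) - (logPotential x - T)| :=
          abs_max_sub_max_le_abs _ _ _
      _ ≤ B i := by rw [sub_sub_sub_cancel_right]; exact hB i x
      _ ≤ ∑ i, |B i| := (le_abs_self _).trans
          (Finset.single_le_sum (f := fun i => |B i|) (fun i _ => abs_nonneg _)
            (Finset.mem_univ i))
  set d : unitInterval → ℝ := fun x => ∑ i, (p i).toReal * (h (f i x) - h x) with hd
  have hdm : Measurable d := Finset.measurable_sum _ fun i _ =>
    measurable_const.mul ((hhm.comp (hfm i)).sub hhm)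
  have hdpos : ∀ x, 0 < x → T < logPotential x → 0 < d x := by
    intro x hx hTx
    have hx' : (0 : ℝ) < x := hx
    have hxε : (x : ℝ) < ε := by
      have h1 := sqrt_coe_le_one x
      simp only [logPotential] at hTx
      exact (Real.log_lt_log_iff hx' hε).1 (by linarith)
    refine (hdrift x hx hxε).trans_le (Finset.sum_le_sum fun i _ => ?_)
    refine mul_le_mul_of_nonneg_left ?_ ENNReal.toReal_nonneg
    have h1 : h x = logPotential x - T := max_eq_left (sub_pos.2 hTx).le
    have h2 : logPotential (f i x) - T ≤ h (f i x) := le_max_left _ _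
    linarith
  have hdnonneg : ∀ x, 0 ≤ d x := by
    intro x
    rcases eq_or_lt_of_le (unitInterval.nonneg' : 0 ≤ x) with rfl | hx
    · simp [hd, hf.map_zero]
    rcases lt_or_ge T (logPotential x) with hTx | hTx
    · exact (hdpos x hx hTx).le
    · have h1 : h x = 0 := max_eq_right (sub_nonpos.2 hTx)
      refine Finset.sum_nonneg fun i _ => mul_nonneg ENNReal.toReal_nonneg ?_
      rw [h1, sub_zero]
      exact le_max_right _ _
  have hdint : Integrable d m := by
    refine integrable_finsetSum _ fun i _ => Integrable.const_mul ?_ _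
    exact Integrable.of_bound ((hhm.comp (hfm i)).sub hhm).aestronglyMeasurable (∑ i, |B i|)
      (ae_of_all _ fun x => hhB i x)
  have hzero := (integral_eq_zero_iff_of_nonneg hdnonneg hdint).1
    (hm.integral_drift_eq_zero hfm hhm (fun x => le_max_right _ _) hhB)
  refine ⟨Real.exp (-T), Real.exp_pos _, measure_mono_null (fun x hx => ?_) (ae_iff.1 hzero)⟩
  refine (hdpos x hx.1 ?_).ne'
  have hx' : (0 : ℝ) < x := hx.1
  have h1 := (Real.log_lt_iff_lt_exp hx').2 hx.2
  have h2 := Real.sqrt_nonneg (x : ℝ)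
  simp only [logPotential]
  linarith

theorem tendsto_iterate_zero {g : unitInterval → unitInterval} (hg : Continuous g) (h0 : g 0 = 0)
    (hlt : ∀ x, 0 < x → x < 1 → g x < x) {x : unitInterval} (hx : x < 1) :
    Tendsto (fun n => g^[n] x) atTop (𝓝 0) := by
  have hstep : ∀ y, y < 1 → g y ≤ y := fun y hy => by
    rcases eq_or_lt_of_le (unitInterval.nonneg' : 0 ≤ y) with rfl | hy0
    · exact h0.le
    · exact (hlt y hy0 hy).le
  have hlt1 : ∀ n, g^[n] x < 1 := fun n => by
    induction n with
    | zero => exact hx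
    | succ n ih => rw [Function.iterate_succ_apply']; exact (hstep _ ih).trans_lt ih
  have hanti : Antitone fun n => g^[n] x := antitone_nat_of_succ_le fun n => by
    rw [Function.iterate_succ_apply']
    exact hstep _ (hlt1 n)
  have hlim := tendsto_atTop_iInf hanti
  have hfix := isFixedPt_of_tendsto_iterate hlim hg.continuousAt
  convert hlim using 2
  by_contra hne
  have hc1 : (⨅ n, g^[n] x) < 1 := (iInf_le _ 0).trans_lt hx
  exact (hlt _ (unitInterval.pos_iff_ne_zero.2 (Ne.symm hne)) hc1).ne hfix

/-- The iterates of `f 0` carry every point of `(0, 1)` into a null set of the form `(0, δ)`. -/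
theorem measure_Ioo_eq_zero {p : PMF (Fin 2)} (hp : ∀ i, 0 < p i)
    {f : Fin 2 → unitInterval → unitInterval} (hf : ClassS f)
    (hnd : ¬ (fiberDeriv (f 0) 0 = 1 ∧ fiberDeriv (f 1) 0 = 1)) (hL0 : lyapunov p f 0 ≤ 0)
    {m : Measure unitInterval} (hm : IsStationary p f m) : m (Ioo 0 1) = 0 := by
  have hfm : ∀ i, Measurable (f i) := fun i => (hf.diffeo i).1.continuous.measurable
  obtain ⟨δ, hδ, hS⟩ := exists_measure_Ioo_eq_zero hp hf hnd hL0 hm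
  set S : Set unitInterval := {x | 0 < x ∧ (x : ℝ) < δ}
  have hSm : MeasurableSet S :=
    measurableSet_Ioi.inter (measurableSet_lt measurable_subtype_coe measurable_const)
  have hpre : ∀ n, m ((f 0)^[n] ⁻¹' S) = 0 := fun n => by
    induction n with
    | zero => exact hS
    | succ n ih =>
      rw [Function.iterate_succ, preimage_comp]
      exact hm.measure_preimage_eq_zero hfm ((hfm 0).iterate n hSm) ih (hp 0)
  refine measure_mono_null (fun x hx => mem_iUnion.2 ?_) (measure_iUnion_null hpre)
  have hlim := tendsto_iterate_zero (hf.diffeo 0).1.continuous (hf.map_zero 0) hf.lt_self hx.2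
  have hlim' : Tendsto (fun n => ((f 0)^[n] x : ℝ)) atTop (𝓝 0) :=
    (continuous_subtype_val.tendsto (0 : unitInterval)).comp hlim
  obtain ⟨n, hn⟩ := (hlim'.eventually_lt_const hδ).exists
  refine ⟨n, ?_, hn⟩
  clear hn
  induction n with
  | zero => exact hx.1
  | succ n ih =>
    rw [Function.iterate_succ_apply']
    exact (hf.diffeo 0).pos (hf.map_zero 0) ih

theorem eq_dirac_of_measure_compl_singleton_eq_zero {M : Type*} [MeasurableSpace M]
    [MeasurableSingletonClass M] {m : Measure M} [IsProbabilityMeasure m] {c : M}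
    (h : m {c}ᶜ = 0) : m = Measure.dirac c := by
  rw [← Measure.restrict_eq_self_of_ae_mem (s := {c}) (μ := m) h, Measure.restrict_singleton,
    (prob_compl_eq_zero_iff (measurableSet_singleton c)).1 h, one_smul]

/-- The set `Σ × {0}` is invariant under the skew product, so an ergodic stationary measure gives
the point `0` mass zero or one. -/
theorem IsErgodicStationary.measure_zero_or_compl {p : PMF (Fin 2)}
    {f : Fin 2 → unitInterval → unitInterval} (hf : ClassS f) {m : Measure unitInterval}
    (hm : IsErgodicStationary p f m) : m {0} = 0 ∨ m {0}ᶜ = 0 := by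
  have := hm.1.1
  have hinv : stepSkewProduct f ⁻¹' (univ ×ˢ {0}) = univ ×ˢ {0} := by
    ext ⟨ω, x⟩
    simp only [stepSkewProduct, mem_preimage, mem_prod, mem_univ, true_and, mem_singleton_iff]
    refine ⟨fun h => ?_, fun h => by rw [h, hf.map_zero]⟩
    by_contra hx
    exact ((hf.diffeo _).pos (hf.map_zero _) (unitInterval.pos_iff_ne_zero.2 hx)).ne' h
  have h := hm.2.measure_self_or_compl_eq_zero
    (MeasurableSet.univ.prod (measurableSet_singleton 0)) hinv
  have hcompl : (univ ×ˢ {0} : Set ((ℕ → Fin 2) × unitInterval))ᶜ = univ ×ˢ {0}ᶜ := by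
    ext
    simp
  rwa [hcompl, Measure.prod_prod, Measure.prod_prod, measure_univ, one_mul, one_mul] at h

end StepSkew

theorem theorem5p3 (p : PMF (Fin 2)) (hp : ∀ i, 0 < p i)
    (f : Fin 2 → unitInterval → unitInterval) (hf : StepSkew.ClassS f)
    (hnd : ¬ (StepSkew.fiberDeriv (f 0) 0 = 1 ∧ StepSkew.fiberDeriv (f 1) 0 = 1))
    (hL0 : StepSkew.lyapunov p f 0 ≤ 0) (hL1 : 0 < StepSkew.lyapunov p f 1) :
    {m : MeasureTheory.Measure unitInterval | StepSkew.IsErgodicStationary p f m} =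
      {MeasureTheory.Measure.dirac 0, MeasureTheory.Measure.dirac 1} := by
  have hfm : ∀ i, Measurable (f i) := fun i => (hf.diffeo i).1.continuous.measurable
  ext m
  simp only [mem_ofPred_eq, mem_insert_iff, mem_singleton_iff]
  constructor
  · intro hm
    have := hm.1.1
    rcases hm.measure_zero_or_compl hf with h0 | h0
    · refine Or.inr (StepSkew.eq_dirac_of_measure_compl_singleton_eq_zero ?_)
      refine measure_mono_null (fun x hx => ?_)
        (measure_union_null h0 (StepSkew.measure_Ioo_eq_zero hp hf hnd hL0 hm.1))
      rcases eq_or_lt_of_le (unitInterval.nonneg' : 0 ≤ x) with h | h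
      · exact Or.inl h.symm
      · exact Or.inr ⟨h, lt_of_le_of_ne unitInterval.le_one' hx⟩
    · exact Or.inl (StepSkew.eq_dirac_of_measure_compl_singleton_eq_zero h0)
  · rintro (rfl | rfl)
    · exact StepSkew.isErgodicStationary_dirac p hfm hf.map_zero
    · exact StepSkew.isErgodicStationary_dirac p hfm hf.map_one
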